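/- Let $E\neq\{0\}$ be a locally convex Hausdorff space over $\mathbb{K}=\mathbb{R}$ or $\mathbb{C}$ with the metric convex compactness property, i.e. the closed absolutely convex hull of every metrisable compact subset of $E$ is compact. Let $-\infty<a<b<\infty$, let $k\in\mathbb{N}$, $k\geq 1$, and let $\mathcal{C}^{k}([a,b],E)$ be the space of all $k$ times continuously differentiable functions $f\colon(a,b)\to E$ all of whose derivatives $f^{(\beta)}$, $0\leq\beta\leq k$, extend continuously to $[a,b]$ (the extension is again denoted by $f^{(\beta)}$), with the locally convex topology given by the seminorms $$|f|_{p}=\sup_{x\in(a,b),\,0\leq\beta\leq k}p\bigl(f^{(\beta)}(x)\bigr),\qquad p\text{ a continuous seminorm on }E.$$ Let $\mathcal{T}=(t_{n})_{n\in\mathbb{N}_{0}}$ be a dense sequence in $[a,b]$ of pairwise different points with $t_{0}=a$ and $t_{1}=b$. For $n\geq 1$ put $T^{n}=\{t_{0},\dots,t_{n}\}$, and for $t\in T^{n}$ let $h^{T^{n}}_{t}\colon[a,b]\to\mathbb{R}$ be the hat function at $t$, i.e. the continuous function that is affine between neighbouring points of $T^{n}$, is $1$ at $t$ and is $0$ at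 the other points of $T^{n}$. Let $\varphi_{0}=h^{T^{1}}_{t_{0}}$, $\varphi_{1}=h^{T^{1}}_{t_{1}}$ and $\varphi_{n}=h^{T^{n}}_{t_{n}}$ for $n\geq 2$ be the Schauder hat functions, and for continuous $g\colon[a,b]\to E$ define recursively $$\lambda_{0}(g)=g(t_{0}),\qquad\lambda_{1}(g)=g(t_{1}),\qquad\lambda_{n+1}(g)=g(t_{n+1})-\sum_{j=0}^{n}\varphi_{j}(t_{n+1})\,\lambda_{j}(g)\quad(n\geq 1).$$ For $f\in\mathcal{C}^{k}([a,b],E)$ and $x\in[a,b]$ put $$f_{n}^{\mathcal{T}}(x)=\frac{(x-a)^{n}}{n!},\quad\mu_{n}(f)=f^{(n)}(a)\qquad(0\leq n\leq k-1),$$ $$f_{n}^{\mathcal{T}}(x)=\int_{a}^{x}\int_{a}^{s_{k-1}}\cdots\int_{a}^{s_{1}}\varphi_{n-k}(s)\,ds\,ds_{1}\cdots ds_{k-1},\quad\mu_{n}(f)=\lambda_{n-k}(f^{(k)})\qquad(n\geq k).$$ Then $f\mapsto\mu_{n}(f)f_{n}^{\mathcal{T}}$ is a continuous linear operator on $\mathcal{C}^{k}([a,b],E)$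 for every $n\in\mathbb{N}_{0}$, and the operators $P_{l}f=\sum_{n=0}^{l}\mu_{n}(f)f_{n}^{\mathcal{T}}$, $l\in\mathbb{N}_{0}$, form a Schauder decomposition of $\mathcal{C}^{k}([a,b],E)$: they are continuous projections with $P_{l}P_{m}=P_{\min(l,m)}$ for all $l,m$, with $P_{l}\neq P_{m}$ for $l\neq m$, and with $P_{l}f\to f$ for every $f$. In particular $$f=\sum_{n=0}^{\infty}\mu_{n}(f)f_{n}^{\mathcal{T}}\quad\text{in }\mathcal{C}^{k}([a,b],E)\text{ for every }f\in\mathcal{C}^{k}([a,b],E).$$ -/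

import Mathlib

open Set Filter Topology

namespace CkInterval

noncomputable section

/-! ### Derivatives of vector-valued functions on an open interval -/

section Derivatives

variable (𝕜 : Type*) [RCLike 𝕜] {E : Type*} [AddCommGroup E] [Module 𝕜 E] [TopologicalSpace E]
  {a b : ℝ}

/-- The function `f : (a,b) → E` is differentiable at `x` with derivative `e`: the difference
quotients `(f y - f x) / (y - x)` converge to `e` in `E` as `y → x`, `y ≠ x`. -/
def HasDeriv (f : Ioo a b → E) (e : E) (x : Ioo a b) : Prop :=
  Tendsto (fun y : Ioo a b => ((((y : ℝ) - (x : ℝ))⁻¹ : ℝ) : 𝕜) • (f y - f x))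
    (𝓝[≠] x) (𝓝 e)

/-- The derivative of `f` (a junk value at the points where `f` is not differentiable). -/
def derivFn (f : Ioo a b → E) : Ioo a b → E := fun x =>
  haveI : Nonempty E := ⟨0⟩
  limUnder (𝓝[≠] x) (fun y : Ioo a b => ((((y : ℝ) - (x : ℝ))⁻¹ : ℝ) : 𝕜) • (f y - f x))

/-- The `n`-th derivative `f^{(n)}`. -/
def iterDeriv : ℕ → (Ioo a b → E) → (Ioo a b → E)
  | 0, f => f
  | n + 1, f => iterDeriv n (derivFn 𝕜 f)

/-- `f : (a,b) → E` is `k` times continuously differentiable. -/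
def IsCk : ℕ → (Ioo a b → E) → Prop
  | 0, f => Continuous f
  | k + 1, f => (∀ x, ∃ e, HasDeriv 𝕜 f e x) ∧ IsCk k (derivFn 𝕜 f)

/-- `G : [a,b] → E` is a continuous extension of `g : (a,b) → E`. -/
def IsContExt (g : Ioo a b → E) (G : C(Icc a b, E)) : Prop :=
  ∀ x : Ioo a b, G ⟨x, Ioo_subset_Icc_self x.2⟩ = g x

open Classical in
/-- The continuous extension to `[a,b]` of a function on `(a,b)` (junk value `0` if there
is none). -/
def contExt (g : Ioo a b → E) : C(Icc a b, E) :=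
  if h : ∃ G : C(Icc a b, E), IsContExt g G then h.choose else 0

variable {𝕜}

theorem isContExt_contExt {g : Ioo a b → E} (h : ∃ G : C(Icc a b, E), IsContExt g G) :
    IsContExt g (contExt g) := by
  rw [contExt, dif_pos h]
  exact h.choose_spec

instance (x : Ioo a b) : (𝓝[≠] x).NeBot :=
  (inferInstance : (𝓝[>] x).NeBot).mono (nhdsWithin_mono x fun _ hy => ne_of_gt hy)

theorem HasDeriv.derivFn_eq [T2Space E] {f : Ioo a b → E} {e : E} {x : Ioo a b}
    (h : HasDeriv 𝕜 f e x) : derivFn 𝕜 f x = e :=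
  Tendsto.limUnder_eq h

theorem HasDeriv.add [IsTopologicalAddGroup E] {f g : Ioo a b → E} {e e' : E} {x : Ioo a b}
    (hf : HasDeriv 𝕜 f e x) (hg : HasDeriv 𝕜 g e' x) : HasDeriv 𝕜 (f + g) (e + e') x := by
  refine (Tendsto.add hf hg).congr fun y => ?_
  rw [← smul_add, Pi.add_apply, Pi.add_apply, add_sub_add_comm]

theorem HasDeriv.const_smul [ContinuousSMul 𝕜 E] {f : Ioo a b → E} {e : E} {x : Ioo a b}
    (c : 𝕜) (hf : HasDeriv 𝕜 f e x) : HasDeriv 𝕜 (c • f) (c • e) x := by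
  refine (Tendsto.const_smul hf c).congr fun y => ?_
  rw [Pi.smul_apply, Pi.smul_apply, ← smul_sub, smul_comm]

theorem hasDeriv_zero (x : Ioo a b) : HasDeriv 𝕜 (0 : Ioo a b → E) 0 x := by
  simpa [HasDeriv] using tendsto_const_nhds

theorem derivFn_add [IsTopologicalAddGroup E] [T2Space E] {f g : Ioo a b → E}
    (hf : ∀ x, ∃ e, HasDeriv 𝕜 f e x) (hg : ∀ x, ∃ e, HasDeriv 𝕜 g e x) :
    derivFn 𝕜 (f + g) = derivFn 𝕜 f + derivFn 𝕜 g := by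
  funext x
  obtain ⟨e, he⟩ := hf x
  obtain ⟨e', he'⟩ := hg x
  rw [(he.add he').derivFn_eq, Pi.add_apply, he.derivFn_eq, he'.derivFn_eq]

theorem derivFn_smul [ContinuousSMul 𝕜 E] [T2Space E] {f : Ioo a b → E} (c : 𝕜)
    (hf : ∀ x, ∃ e, HasDeriv 𝕜 f e x) :
    derivFn 𝕜 (c • f) = c • derivFn 𝕜 f := by
  funext x
  obtain ⟨e, he⟩ := hf x
  rw [(he.const_smul c).derivFn_eq, Pi.smul_apply, he.derivFn_eq]

theorem derivFn_zero [T2Space E] : derivFn 𝕜 (0 : Ioo a b → E) = 0 :=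
  funext fun x => (hasDeriv_zero x).derivFn_eq

theorem isCk_zero [T2Space E] (k : ℕ) : IsCk 𝕜 k (0 : Ioo a b → E) := by
  induction k with
  | zero => exact continuous_zero
  | succ k ih => exact ⟨fun x => ⟨0, hasDeriv_zero x⟩, by rwa [derivFn_zero]⟩

theorem iterDeriv_zero_fun [T2Space E] (n : ℕ) : iterDeriv 𝕜 n (0 : Ioo a b → E) = 0 := by
  induction n with
  | zero => rfl
  | succ n ih => rw [iterDeriv, derivFn_zero, ih]

theorem IsCk.add [IsTopologicalAddGroup E] [T2Space E] {k : ℕ} {f g : Ioo a b → E}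
    (hf : IsCk 𝕜 k f) (hg : IsCk 𝕜 k g) : IsCk 𝕜 k (f + g) := by
  induction k generalizing f g with
  | zero => exact Continuous.add hf hg
  | succ k ih =>
    refine ⟨fun x => ?_, ?_⟩
    · obtain ⟨e, he⟩ := hf.1 x
      obtain ⟨e', he'⟩ := hg.1 x
      exact ⟨_, he.add he'⟩
    · rw [derivFn_add hf.1 hg.1]
      exact ih hf.2 hg.2

theorem IsCk.const_smul [ContinuousSMul 𝕜 E] [T2Space E] {k : ℕ} {f : Ioo a b → E} (c : 𝕜)
    (hf : IsCk 𝕜 k f) : IsCk 𝕜 k (c • f) := by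
  induction k generalizing f with
  | zero => exact Continuous.const_smul hf c
  | succ k ih =>
    refine ⟨fun x => ?_, ?_⟩
    · obtain ⟨e, he⟩ := hf.1 x
      exact ⟨_, he.const_smul c⟩
    · rw [derivFn_smul c hf.1]
      exact ih hf.2

theorem iterDeriv_add [IsTopologicalAddGroup E] [T2Space E] {k n : ℕ} (hn : n ≤ k)
    {f g : Ioo a b → E} (hf : IsCk 𝕜 k f) (hg : IsCk 𝕜 k g) :
    iterDeriv 𝕜 n (f + g) = iterDeriv 𝕜 n f + iterDeriv 𝕜 n g := by
  induction k generalizing n f g with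
  | zero => obtain rfl : n = 0 := by omega
            rfl
  | succ k ih =>
    cases n with
    | zero => rfl
    | succ n =>
      rw [iterDeriv, derivFn_add hf.1 hg.1, ih (by omega) hf.2 hg.2]
      rfl

theorem iterDeriv_smul [ContinuousSMul 𝕜 E] [T2Space E] {k n : ℕ} (hn : n ≤ k) (c : 𝕜)
    {f : Ioo a b → E} (hf : IsCk 𝕜 k f) :
    iterDeriv 𝕜 n (c • f) = c • iterDeriv 𝕜 n f := by
  induction k generalizing n f with
  | zero => obtain rfl : n = 0 := by omega
            rfl
  | succ k ih =>
    cases n with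
    | zero => rfl
    | succ n =>
      rw [iterDeriv, derivFn_smul c hf.1, ih (by omega) hf.2]
      rfl

end Derivatives

/-! ### The locally convex space `C^k([a,b], E)` -/

section Space

variable (𝕜 : Type*) [RCLike 𝕜] (E : Type*) [AddCommGroup E] [Module 𝕜 E] [TopologicalSpace E]
  [IsTopologicalAddGroup E] [ContinuousSMul 𝕜 E] [T2Space E] (a b : ℝ) (k : ℕ)

/-- The vector space of the `C^k` functions `f : (a,b) → E` all of whose derivatives `f^{(n)}`,
`n ≤ k`, extend continuously to `[a,b]`. -/
def ckSubmodule : Submodule 𝕜 (Ioo a b → E) where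
  carrier := {f | IsCk 𝕜 k f ∧
    ∀ n ≤ k, ∃ G : C(Icc a b, E), IsContExt (iterDeriv 𝕜 n f) G}
  zero_mem' := ⟨isCk_zero k, fun n _ => ⟨0, fun x => by rw [iterDeriv_zero_fun]; rfl⟩⟩
  add_mem' := by
    rintro f g ⟨hf, hf'⟩ ⟨hg, hg'⟩
    refine ⟨hf.add hg, fun n hn => ?_⟩
    obtain ⟨F, hF⟩ := hf' n hn
    obtain ⟨G, hG⟩ := hg' n hn
    refine ⟨F + G, fun x => ?_⟩
    rw [iterDeriv_add hn hf hg, Pi.add_apply, ContinuousMap.add_apply, hF x, hG x]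
  smul_mem' := by
    rintro c f ⟨hf, hf'⟩
    refine ⟨hf.const_smul c, fun n hn => ?_⟩
    obtain ⟨F, hF⟩ := hf' n hn
    refine ⟨c • F, fun x => ?_⟩
    rw [iterDeriv_smul hn c hf, Pi.smul_apply, ContinuousMap.smul_apply, hF x]

/-- The space `C^k([a,b], E)`. It is a type of its own, so that it does not inherit the topology
of pointwise convergence from the functions `(a,b) → E`. -/
def Ck : Type _ := ↥(ckSubmodule 𝕜 E a b k)

instance : AddCommGroup (Ck 𝕜 E a b k) := inferInstanceAs (AddCommGroup ↥(ckSubmodule 𝕜 E a b k))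

instance : Module 𝕜 (Ck 𝕜 E a b k) := inferInstanceAs (Module 𝕜 ↥(ckSubmodule 𝕜 E a b k))

instance : CoeFun (Ck 𝕜 E a b k) (fun _ => Ioo a b → E) := ⟨fun f => f.1⟩

variable {𝕜 E a b k}

/-- `f^{(n)}`, for `n ≤ k`, as a continuous function on the closed interval `[a,b]`. -/
def Ck.deriv (f : Ck 𝕜 E a b k) (n : ℕ) : C(Icc a b, E) := contExt (iterDeriv 𝕜 n f)

theorem Ck.deriv_apply (f : Ck 𝕜 E a b k) {n : ℕ} (hn : n ≤ k) (x : Ioo a b) :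
    f.deriv n ⟨x, Ioo_subset_Icc_self x.2⟩ = iterDeriv 𝕜 n f x :=
  isContExt_contExt (f.2.2 n hn) x

theorem Ck.bddAbove (f : Ck 𝕜 E a b k) (p : Seminorm 𝕜 E) (hp : Continuous p) :
    BddAbove (range fun q : Ioo a b × Fin (k + 1) => p (iterDeriv 𝕜 (q.2 : ℕ) f q.1)) := by
  have h : ∀ j : Fin (k + 1), ∃ C : ℝ, ∀ x : Ioo a b, p (iterDeriv 𝕜 (j : ℕ) f x) ≤ C := by
    intro j
    obtain ⟨C, hC⟩ := (isCompact_range (hp.comp (f.deriv j).continuous)).bddAbove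
    refine ⟨C, fun x => ?_⟩
    rw [← f.deriv_apply (Nat.lt_succ_iff.mp j.2) x]
    exact hC ⟨_, rfl⟩
  choose C hC using h
  refine ⟨∑ j, |C j|, ?_⟩
  rintro _ ⟨⟨x, j⟩, rfl⟩
  exact ((hC j x).trans (le_abs_self _)).trans
    (Finset.single_le_sum (f := fun j => |C j|) (fun i _ => abs_nonneg _) (Finset.mem_univ j))

/-- The seminorm `|f|_p = sup { p (f^{(n)}(x)) | x ∈ (a,b), n ≤ k }` on `C^k([a,b], E)`
associated with a continuous seminorm `p` of `E`. -/
def Ck.seminorm (p : {p : Seminorm 𝕜 E // Continuous p}) : Seminorm 𝕜 (Ck 𝕜 E a b k) :=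
  Seminorm.of
    (fun f => ⨆ q : Ioo a b × Fin (k + 1), p.1 (iterDeriv 𝕜 (q.2 : ℕ) f q.1))
    (by
      intro f g
      refine Real.iSup_le (fun q => ?_) (add_nonneg
        (Real.iSup_nonneg fun q => apply_nonneg _ _) (Real.iSup_nonneg fun q => apply_nonneg _ _))
      have h : iterDeriv 𝕜 (q.2 : ℕ) (f + g : Ck 𝕜 E a b k) q.1 =
          iterDeriv 𝕜 (q.2 : ℕ) f q.1 + iterDeriv 𝕜 (q.2 : ℕ) g q.1 :=
        congrFun (iterDeriv_add (Nat.lt_succ_iff.mp q.2.2) f.2.1 g.2.1) q.1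
      rw [h]
      exact (map_add_le_add p.1 _ _).trans
        (add_le_add (le_ciSup (f.bddAbove p.1 p.2) q) (le_ciSup (g.bddAbove p.1 p.2) q)))
    (by
      intro c f
      rw [Real.mul_iSup_of_nonneg (norm_nonneg c)]
      congr 1
      funext q
      have h : iterDeriv 𝕜 (q.2 : ℕ) (c • f : Ck 𝕜 E a b k) q.1 =
          c • iterDeriv 𝕜 (q.2 : ℕ) f q.1 :=
        congrFun (iterDeriv_smul (Nat.lt_succ_iff.mp q.2.2) c f.2.1) q.1
      rw [h, map_smul_eq_mul])

/-- `C^k([a,b], E)` carries the topology of the seminorms `|·|_p`, where `p` runs through the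
continuous seminorms of `E`. -/
instance : TopologicalSpace (Ck 𝕜 E a b k) :=
  (show SeminormFamily 𝕜 (Ck 𝕜 E a b k) {p : Seminorm 𝕜 E // Continuous p} from
    Ck.seminorm).moduleFilterBasis.topology

theorem Ck.withSeminorms :
    WithSeminorms (show SeminormFamily 𝕜 (Ck 𝕜 E a b k) {p : Seminorm 𝕜 E // Continuous p} from
      Ck.seminorm) := ⟨rfl⟩

instance : IsTopologicalAddGroup (Ck 𝕜 E a b k) := Ck.withSeminorms.topologicalAddGroup

instance : ContinuousSMul 𝕜 (Ck 𝕜 E a b k) := Ck.withSeminorms.continuousSMul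

end Space

/-! ### Schauder hat functions, basis functions and coefficients -/

section Basis

/-- The hat function at the point `p` of the finite set `T ⊂ ℝ`: with `p⁻` the predecessor and
`p⁺` the successor of `p` in `T`, it is `(x - p⁻) / (p - p⁻)` on `[p⁻, p]`,
`(p⁺ - x) / (p⁺ - p)` on `[p, p⁺]` and `0` elsewhere; the part belonging to a neighbour that does
not exist is left out. -/
def hat (T : Finset ℝ) (p x : ℝ) : ℝ :=
  open Classical in
  if (∃ q ∈ T, q < p) ∧ sSup {q : ℝ | q ∈ T ∧ q < p} ≤ x ∧ x ≤ p then
    (x - sSup {q : ℝ | q ∈ T ∧ q < p}) / (p - sSup {q : ℝ | q ∈ T ∧ q < p})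
  else if (∃ q ∈ T, p < q) ∧ p ≤ x ∧ x ≤ sInf {q : ℝ | q ∈ T ∧ p < q} then
    (sInf {q : ℝ | q ∈ T ∧ p < q} - x) / (sInf {q : ℝ | q ∈ T ∧ p < q} - p)
  else 0

variable {a b : ℝ}

/-- The finite set `T^n = {t_0, …, t_n}`. -/
def nodes (t : ℕ → Icc a b) (n : ℕ) : Finset ℝ :=
  (Finset.range (n + 1)).image fun j => (t j : ℝ)

/-- The Schauder hat functions of the sequence `t`: the hat functions of `T^1` at `t_0` and `t_1`,
and the hat function of `T^n` at `t_n` for `n ≥ 2`. -/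
def schauderHat (t : ℕ → Icc a b) : ℕ → ℝ → ℝ
  | 0 => hat (nodes t 1) (t 0)
  | 1 => hat (nodes t 1) (t 1)
  | n + 2 => hat (nodes t (n + 2)) (t (n + 2))

/-- The basis functions: `(x - a)^n / n!` for `n < k`, and for `n ≥ k` the Schauder hat function
with index `n - k` integrated `k` times from `a`. -/
def basisFn (k : ℕ) (t : ℕ → Icc a b) (n : ℕ) : ℝ → ℝ :=
  if n < k then fun x => (x - a) ^ n / (n.factorial : ℝ)
  else (fun g : ℝ → ℝ => fun x => ∫ s in a..x, g s)^[k] (schauderHat t (n - k))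

variable (𝕜 : Type*) [RCLike 𝕜] {E : Type*} [AddCommGroup E] [Module 𝕜 E]

/-- The coefficients `λ_n(g)` of `g : [a,b] → E` with respect to the Schauder hat functions. -/
def hatCoeff (t : ℕ → Icc a b) (g : Icc a b → E) : ℕ → E
  | 0 => g (t 0)
  | 1 => g (t 1)
  | n + 2 => g (t (n + 2)) -
      ∑ j : Fin (n + 2), ((schauderHat t j (t (n + 2)) : ℝ) : 𝕜) • hatCoeff t g j
termination_by n => n
decreasing_by exact j.2

variable {𝕜} [TopologicalSpace E] [IsTopologicalAddGroup E] [ContinuousSMul 𝕜 E] [T2Space E]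

/-- The coefficients `μ_n(f)` of `f ∈ C^k([a,b], E)`: `f^{(n)}(a)` for `n < k` and
`λ_{n-k}(f^{(k)})` for `n ≥ k`. -/
def coeff (hab : a < b) {k : ℕ} (t : ℕ → Icc a b) (n : ℕ) (f : Ck 𝕜 E a b k) : E :=
  if n < k then f.deriv n ⟨a, left_mem_Icc.mpr hab.le⟩
  else hatCoeff 𝕜 t (f.deriv k) (n - k)

end Basis

/-- `E` has the metric convex compactness property: the closed absolutely convex hull of every
metrizable compact subset of `E` is compact. -/
def MetricCCP (𝕜 : Type*) [RCLike 𝕜] (E : Type*) [AddCommGroup E] [Module 𝕜 E]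
    [TopologicalSpace E] : Prop :=
  open scoped ComplexOrder in
  ∀ K : Set E, IsCompact K → TopologicalSpace.MetrizableSpace K →
    IsCompact (closure (absConvexHull 𝕜 K))

/-- A sequence of continuous linear operators on a topological vector space `F` is a Schauder
decomposition of `F`. The operators are projections by `comp_eq` with `i = j`. -/
structure IsSchauderDecomposition {𝕜 : Type*} [RCLike 𝕜] {F : Type*} [AddCommGroup F] [Module 𝕜 F]
    [TopologicalSpace F] (P : ℕ → F →L[𝕜] F) : Prop where
  comp_eq : ∀ i j, (P i).comp (P j) = P (min i j)
  ne : ∀ i j, i ≠ j → P i ≠ P j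
  tendsto : ∀ f, Tendsto (fun n => P n f) atTop (𝓝 f)

end

end CkInterval

/-! The Schauder hats are triangular at the nodes: `φ_j(t_j) = 1` and `φ_j(t_i) = 0` for `i < j`.
The recursion for `λ_n` is forward substitution in this system, so `∑_{j ≤ l} λ_j(g) φ_j` is the
piecewise linear interpolant of `g` at `t_0, …, t_l` (`sum_schauderHat_smul_hatCoeff`). Density of
the nodes and uniform continuity make it converge to `g` uniformly for every continuous seminorm
(`exists_forall_seminorm_sub_sum_le`).

For `f` in `C^k` and `l ≥ k`, the remainder `f - P_l f` has vanishing derivatives of order `< k` at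
`a`, because the Taylor terms reproduce these values and the integrated hats vanish there. Its
`k`-th derivative is the interpolation error of `f^(k)`. A mean value inequality for seminorms, used
`k` times (`Ck.seminorm_le_of_deriv_le`), carries the smallness of the `k`-th derivative to all
lower orders; only real functions are ever integrated.

The algebraic claims follow from the biorthogonality `μ_m(f_n e) = δ_{mn} e`
(`coeff_toCLM_basisDeriv`): the terms `f ↦ μ_n(f) f_n` are mutually annihilating idempotents,
nonzero since `E ≠ 0`. -/

namespace CkInterval

noncomputable section

/-! ### Derivatives on the closed interval, real `C^k` functions times vectors, and the mean value
inequality. -/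

section Space

variable {𝕜 : Type*} [RCLike 𝕜] {E : Type*} [AddCommGroup E] [Module 𝕜 E] [TopologicalSpace E]
  {a b : ℝ}

theorem IsCk.hasDeriv_iterDeriv [T2Space E] {k n : ℕ} (hn : n < k) {f : Ioo a b → E}
    (hf : IsCk 𝕜 k f) (x : Ioo a b) :
    HasDeriv 𝕜 (iterDeriv 𝕜 n f) (iterDeriv 𝕜 (n + 1) f x) x := by
  induction n generalizing k f with
  | zero =>
    obtain ⟨k, rfl⟩ : ∃ l, k = l + 1 := ⟨k - 1, by omega⟩
    obtain ⟨e, he⟩ := hf.1 x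
    simpa only [iterDeriv, he.derivFn_eq] using he
  | succ n ih =>
    obtain ⟨k, rfl⟩ : ∃ l, k = l + 1 := ⟨k - 1, by omega⟩
    exact ih (by omega) hf.2

/-- Makes continuous extensions to `[a,b]` unique and carries closed conditions from `(a,b)` to the
endpoints. -/
theorem denseRange_Ioo_Icc (hab : a < b) :
    DenseRange (fun x : Ioo a b => (⟨x, Ioo_subset_Icc_self x.2⟩ : Icc a b)) := by
  rw [DenseRange, Subtype.dense_iff]
  intro x hx
  rw [← closure_Ioo hab.ne] at hx
  refine closure_mono ?_ hx
  intro y hy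
  exact ⟨⟨y, Ioo_subset_Icc_self hy⟩, ⟨⟨y, hy⟩, rfl⟩, rfl⟩

theorem IsContExt.contExt_eq [T2Space E] (hab : a < b) {g : Ioo a b → E} {G : C(Icc a b, E)}
    (h : IsContExt g G) : contExt g = G := by
  have h' := isContExt_contExt ⟨G, h⟩
  refine ContinuousMap.ext fun x => congrFun ((denseRange_Ioo_Icc hab).equalizer
    (contExt g).continuous G.continuous ?_) x
  funext y
  exact (h' y).trans (h y).symm

/-- A family of real functions on `[a,b]`, each of the first `k` of which is an antiderivative of
the next one. -/
structure IsDerivChain (a b : ℝ) (k : ℕ) (F : ℕ → ℝ → ℝ) : Prop where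
  hasDerivAt : ∀ n < k, ∀ x ∈ Ioo a b, HasDerivAt (F n) (F (n + 1) x) x
  continuousOn : ∀ n ≤ k, ContinuousOn (F n) (Icc a b)

theorem IsDerivChain.shift {k : ℕ} {F : ℕ → ℝ → ℝ} (hF : IsDerivChain a b (k + 1) F) :
    IsDerivChain a b k fun n => F (n + 1) :=
  ⟨fun n hn => hF.hasDerivAt (n + 1) (by omega), fun n hn => hF.continuousOn (n + 1) (by omega)⟩

section Scalar

variable [ContinuousSMul 𝕜 E]

theorem hasDeriv_ofReal_smul {B : ℝ → ℝ} {B' : ℝ} {x : Ioo a b} (h : HasDerivAt B B' x) (e : E) :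
    HasDeriv 𝕜 (fun y : Ioo a b => ((B y : ℝ) : 𝕜) • e) ((B' : 𝕜) • e) x := by
  have hval : Tendsto ((↑) : Ioo a b → ℝ) (𝓝[≠] x) (𝓝[≠] (x : ℝ)) :=
    tendsto_nhdsWithin_of_tendsto_nhds_of_eventually_within _
      (continuous_subtype_val.continuousAt.mono_left nhdsWithin_le_nhds)
      (eventually_nhdsWithin_of_forall fun y hy h => hy (Subtype.ext h))
  have h1 := (RCLike.continuous_ofReal (K := 𝕜)).continuousAt.tendsto.comp
    ((hasDerivAt_iff_tendsto_slope.mp h).comp hval)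
  refine (h1.smul_const e).congr fun y => ?_
  simp only [Function.comp_apply, slope_def_field, ← sub_smul, smul_smul]
  congr 1
  push_cast
  rw [div_eq_inv_mul]

theorem continuous_ofReal_smul {B : ℝ → ℝ} {s : Set ℝ} (hB : ContinuousOn B s) (e : E) :
    Continuous fun y : s => ((B y : ℝ) : 𝕜) • e :=
  (RCLike.continuous_ofReal.comp hB.domRestrict).smul continuous_const

variable [T2Space E]

/-- `iterDeriv` differentiates the innermost function, so the induction replaces the chain by its
shift. -/
theorem IsDerivChain.iterDeriv_eq {k : ℕ} {F : ℕ → ℝ → ℝ} (hF : IsDerivChain a b k F) (e : E)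
    {n : ℕ} (hn : n ≤ k) :
    iterDeriv 𝕜 n (fun y : Ioo a b => ((F 0 y : ℝ) : 𝕜) • e) =
      fun y : Ioo a b => ((F n y : ℝ) : 𝕜) • e := by
  induction k generalizing F n with
  | zero => obtain rfl : n = 0 := by omega
            rfl
  | succ k ih =>
    cases n with
    | zero => rfl
    | succ n =>
      have h : derivFn 𝕜 (fun y : Ioo a b => ((F 0 y : ℝ) : 𝕜) • e) =
          fun y : Ioo a b => ((F 1 y : ℝ) : 𝕜) • e := funext fun x =>
        (hasDeriv_ofReal_smul (hF.hasDerivAt 0 (by omega) x x.2) e).derivFn_eq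
      rw [iterDeriv, h]
      exact ih hF.shift (by omega)

theorem IsDerivChain.isCk {k : ℕ} {F : ℕ → ℝ → ℝ} (hF : IsDerivChain a b k F) (e : E) :
    IsCk 𝕜 k (fun y : Ioo a b => ((F 0 y : ℝ) : 𝕜) • e) := by
  induction k generalizing F with
  | zero => exact continuous_ofReal_smul ((hF.continuousOn 0 le_rfl).mono Ioo_subset_Icc_self) e
  | succ k ih =>
    have h (x : Ioo a b) := hasDeriv_ofReal_smul (𝕜 := 𝕜) (hF.hasDerivAt 0 (by omega) x x.2) e
    exact ⟨fun x => ⟨_, h x⟩, by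
      rw [show derivFn 𝕜 (fun y : Ioo a b => ((F 0 y : ℝ) : 𝕜) • e) =
        fun y : Ioo a b => ((F 1 y : ℝ) : 𝕜) • e from funext fun x => (h x).derivFn_eq]
      exact ih hF.shift⟩

theorem IsDerivChain.isContExt {k : ℕ} {F : ℕ → ℝ → ℝ} (hF : IsDerivChain a b k F) (e : E)
    {n : ℕ} (hn : n ≤ k) :
    IsContExt (iterDeriv 𝕜 n (fun y : Ioo a b => ((F 0 y : ℝ) : 𝕜) • e))
      ⟨_, continuous_ofReal_smul (𝕜 := 𝕜) (hF.continuousOn n hn) e⟩ := fun x => by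
  rw [hF.iterDeriv_eq e hn]
  rfl

end Scalar

variable [IsTopologicalAddGroup E] [ContinuousSMul 𝕜 E] [T2Space E] {k : ℕ}

namespace Ck

theorem deriv_add (hab : a < b) (f g : Ck 𝕜 E a b k) {n : ℕ} (hn : n ≤ k) :
    (f + g).deriv n = f.deriv n + g.deriv n := by
  refine IsContExt.contExt_eq hab fun x => ?_
  have h : iterDeriv 𝕜 n (f + g : Ck 𝕜 E a b k) x = iterDeriv 𝕜 n f x + iterDeriv 𝕜 n g x :=
    congrFun (iterDeriv_add hn f.2.1 g.2.1) x
  rw [h, ContinuousMap.add_apply, f.deriv_apply hn, g.deriv_apply hn]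

theorem deriv_smul (hab : a < b) (c : 𝕜) (f : Ck 𝕜 E a b k) {n : ℕ} (hn : n ≤ k) :
    (c • f).deriv n = c • f.deriv n := by
  refine IsContExt.contExt_eq hab fun x => ?_
  have h : iterDeriv 𝕜 n (c • f : Ck 𝕜 E a b k) x = c • iterDeriv 𝕜 n f x :=
    congrFun (iterDeriv_smul hn c f.2.1) x
  rw [h, ContinuousMap.smul_apply, f.deriv_apply hn]

theorem deriv_le_seminorm (hab : a < b) (p : {p : Seminorm 𝕜 E // Continuous p})
    (f : Ck 𝕜 E a b k) {n : ℕ} (hn : n ≤ k) (x : Icc a b) :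
    p.1 (f.deriv n x) ≤ Ck.seminorm p f := by
  have hcl : IsClosed {x : Icc a b | p.1 (f.deriv n x) ≤ Ck.seminorm p f} :=
    isClosed_le (p.2.comp (f.deriv n).continuous) continuous_const
  refine (denseRange_Ioo_Icc hab).induction_on x hcl fun y => ?_
  rw [f.deriv_apply hn]
  exact le_ciSup (f.bddAbove p.1 p.2) (y, ⟨n, by omega⟩)

theorem seminorm_le (p : {p : Seminorm 𝕜 E // Continuous p}) (f : Ck 𝕜 E a b k) {M : ℝ}
    (hM : 0 ≤ M) (h : ∀ n ≤ k, ∀ x, p.1 (f.deriv n x) ≤ M) : Ck.seminorm p f ≤ M := by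
  refine Real.iSup_le (fun q => ?_) hM
  rw [← f.deriv_apply (Nat.lt_succ_iff.mp q.2.2)]
  exact h _ (Nat.lt_succ_iff.mp q.2.2) _

/-- The `n`-th derivative at a point of `[a,b]`, as a linear map. -/
def derivAt (hab : a < b) {n : ℕ} (hn : n ≤ k) (x : Icc a b) : Ck 𝕜 E a b k →ₗ[𝕜] E where
  toFun f := f.deriv n x
  map_add' f g := by rw [deriv_add hab f g hn]; rfl
  map_smul' c f := by rw [deriv_smul hab c f hn]; rfl

theorem continuous_deriv_apply [PolynormableSpace 𝕜 E] (hab : a < b) {n : ℕ} (hn : n ≤ k)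
    (x : Icc a b) : Continuous fun f : Ck 𝕜 E a b k => f.deriv n x :=
  (PolynormableSpace.withSeminorms 𝕜 E).continuous_of_continuous_comp (derivAt hab hn x) fun p =>
    Seminorm.continuous_of_le (Ck.withSeminorms.continuous_seminorm p) fun f =>
      f.deriv_le_seminorm hab p hn x

theorem deriv_sub (hab : a < b) (f g : Ck 𝕜 E a b k) {n : ℕ} (hn : n ≤ k) (x : Icc a b) :
    (f - g).deriv n x = f.deriv n x - g.deriv n x := by
  have h := deriv_add hab (f - g) g hn
  rw [sub_add_cancel] at h
  rw [h, ContinuousMap.add_apply, add_sub_cancel_right]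

/-- Mean value inequality with respect to a continuous seminorm. -/
theorem deriv_le_of_deriv_succ_le (hab : a < b) (p : Seminorm 𝕜 E) (hp : Continuous p)
    (f : Ck 𝕜 E a b k) {n : ℕ} (hn : n < k) {M : ℝ} (hM : ∀ x, p (f.deriv (n + 1) x) ≤ M)
    (x : Icc a b) :
    p (f.deriv n x) ≤ p (f.deriv n ⟨a, left_mem_Icc.mpr hab.le⟩) + M * (x - a) := by
  -- Composing with the projection onto `[a,b]` gives a function continuous on all of `ℝ`.
  set h : ℝ → ℝ := fun y => p (f.deriv n (projIcc a b hab.le y)) with hh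
  have hcont : Continuous h := hp.comp ((f.deriv n).continuous.comp continuous_projIcc)
  have hIcc (y : Icc a b) : h y = p (f.deriv n y) := by simp only [hh, projIcc_val]
  have hIoo (y : Ioo a b) : h y = p (iterDeriv 𝕜 n f y) := by
    rw [← f.deriv_apply hn.le, ← hIcc]
  -- Difference quotients are controlled only inside `(a,b)`, so the estimate starts at `c > a`; `c
  -- → a` is taken at the end.
  have key : ∀ c ∈ Ioo a (x : ℝ), h x ≤ h c + M * (x - c) := by
    intro c hc
    have hcb : c < b := hc.2.trans_le x.2.2
    refine image_le_of_liminf_slope_right_le_deriv_boundary (a := c) (b := b)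
      (B := fun y => h c + M * (y - c)) (B' := fun _ => M) hcont.continuousOn (by simp)
      (by fun_prop) (fun y _ => ?_) (fun y hy r hr => ?_) ⟨hc.2.le, x.2.2⟩
    · simpa using ((((hasDerivAt_id y).sub_const c).const_mul M).const_add (h c)).hasDerivWithinAt
    -- `p ∘ f^(n)` need not be differentiable, but a bound on right slopes suffices: by the reverse
    -- triangle inequality they are at most `p` of the difference quotient, which tends to `p
    -- (f^(n+1) z) ≤ M < r`.
    · set z : Ioo a b := ⟨y, hc.1.trans_le hy.1, hy.2⟩ with hz
      have hd := f.2.1.hasDeriv_iterDeriv hn z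
      have hd' := (hp.continuousAt.tendsto.comp hd).mono_left
        (nhdsWithin_mono z fun _ hy => ne_of_gt hy : 𝓝[>] z ≤ 𝓝[≠] z)
      have hlt : p (iterDeriv 𝕜 (n + 1) f z) < r := by
        rw [← f.deriv_apply hn]
        exact (hM _).trans_lt hr
      have hval : Tendsto ((↑) : Ioo a b → ℝ) (𝓝[>] z) (𝓝[>] y) :=
        tendsto_nhdsWithin_of_tendsto_nhds_of_eventually_within _
          (continuous_subtype_val.continuousAt.mono_left nhdsWithin_le_nhds)
          (eventually_nhdsWithin_of_forall fun w hw => hw)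
      refine hval.frequently (Eventually.frequently ?_)
      filter_upwards [hd'.eventually (gt_mem_nhds hlt), self_mem_nhdsWithin] with w hw hzw
      refine lt_of_le_of_lt ?_ hw
      have hzw' : (0 : ℝ) < w - y := sub_pos.mpr hzw
      rw [slope_def_field, Function.comp_apply, map_smul_eq_mul, RCLike.norm_ofReal,
        abs_of_pos (inv_pos.mpr hzw'), div_eq_inv_mul, show y = (z : ℝ) from rfl, hIoo, hIoo]
      exact mul_le_mul_of_nonneg_left ((le_abs_self _).trans (abs_sub_map_le_sub p _ _)) (inv_pos.mpr hzw').le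
  rcases x.2.1.eq_or_lt with hx | hx
  · have : x = ⟨a, left_mem_Icc.mpr hab.le⟩ := Subtype.ext hx.symm
    rw [this]
    simp
  · have hcl : IsClosed {c : ℝ | h x ≤ h c + M * (x - c)} :=
      isClosed_le continuous_const (by fun_prop)
    have ha : a ∈ closure (Ioo a (x : ℝ)) := by
      rw [closure_Ioo hx.ne]
      exact left_mem_Icc.mpr hx.le
    have := hcl.closure_subset_iff.mpr key ha
    rw [mem_ofPred_eq, hIcc] at this
    rwa [← hIcc ⟨a, _⟩]

/-- If all derivatives of order `< k` vanish at `a`, then a bound of the `k`-th derivative bounds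
the function in `C^k([a,b], E)`. -/
theorem seminorm_le_of_deriv_le (hab : a < b) (p : {p : Seminorm 𝕜 E // Continuous p})
    (f : Ck 𝕜 E a b k) (h0 : ∀ n < k, f.deriv n ⟨a, left_mem_Icc.mpr hab.le⟩ = 0) {M : ℝ}
    (hM0 : 0 ≤ M) (hM : ∀ x, p.1 (f.deriv k x) ≤ M) :
    Ck.seminorm p f ≤ M * (1 + (b - a)) ^ k := by
  have hba : 0 ≤ b - a := (sub_pos.mpr hab).le
  -- Each step down in order costs a factor at most `b - a`. The larger factor `1 + (b - a) ≥ 1` has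
  -- monotone powers, so its `k`-th power serves all orders.
  have key : ∀ j ≤ k, ∀ x, p.1 (f.deriv (k - j) x) ≤ M * (1 + (b - a)) ^ j := by
    intro j
    induction j with
    | zero => simpa using hM
    | succ j ih =>
      intro hj x
      have h1 := f.deriv_le_of_deriv_succ_le hab p.1 p.2 (n := k - (j + 1)) (by omega)
        (M := M * (1 + (b - a)) ^ j)
        (by rw [show k - (j + 1) + 1 = k - j by omega]; exact ih (by omega)) x
      rw [h0 _ (by omega), map_zero, zero_add] at h1
      refine h1.trans ?_
      rw [pow_succ, ← mul_assoc]
      have := x.2.2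
      exact mul_le_mul_of_nonneg_left (by linarith) (by positivity)
  refine f.seminorm_le p (by positivity) fun n hn x => ?_
  have := key (k - n) (by omega) x
  rw [show k - (k - n) = n by omega] at this
  refine this.trans (mul_le_mul_of_nonneg_left ?_ hM0)
  exact pow_le_pow_right₀ (by linarith) (by omega)

end Ck

/-- The map `e ↦ (x ↦ F₀(x) e)` from `E` to `C^k([a,b], E)` for a real `C^k` function `F₀`. -/
def IsDerivChain.toLinearMap {F : ℕ → ℝ → ℝ} (hF : IsDerivChain a b k F) :
    E →ₗ[𝕜] Ck 𝕜 E a b k where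
  toFun e := ⟨fun y => ((F 0 y : ℝ) : 𝕜) • e, hF.isCk e, fun _ hn => ⟨_, hF.isContExt e hn⟩⟩
  map_add' _ _ := Subtype.ext (funext fun _ => smul_add _ _ _)
  map_smul' _ _ := Subtype.ext (funext fun _ => smul_comm _ _ _)

theorem IsDerivChain.deriv_toLinearMap (hab : a < b) {F : ℕ → ℝ → ℝ} (hF : IsDerivChain a b k F)
    (e : E) {n : ℕ} (hn : n ≤ k) (x : Icc a b) :
    (hF.toLinearMap (𝕜 := 𝕜) e).deriv n x = ((F n x : ℝ) : 𝕜) • e :=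
  DFunLike.congr_fun ((hF.isContExt e hn).contExt_eq hab) x

theorem IsDerivChain.continuous_toLinearMap (hab : a < b) {F : ℕ → ℝ → ℝ}
    (hF : IsDerivChain a b k F) : Continuous (hF.toLinearMap (𝕜 := 𝕜) (E := E)) := by
  -- One constant for all orders `n ≤ k`, in `NNReal` so that `C • p` is again a seminorm.
  have hC : ∃ C : NNReal, ∀ n ≤ k, ∀ x : Icc a b, |F n x| ≤ C := by
    have h (n : ℕ) : ∃ C : NNReal, n ≤ k → ∀ x : Icc a b, |F n x| ≤ C := by
      by_cases hn : n ≤ k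
      · obtain ⟨C, hC⟩ := isCompact_Icc.exists_bound_of_continuousOn (hF.continuousOn n hn)
        exact ⟨C.toNNReal, fun _ x => (hC x x.2).trans (Real.le_coe_toNNReal C)⟩
      · exact ⟨0, fun h => absurd h hn⟩
    choose C hC using h
    refine ⟨∑ n ∈ Finset.range (k + 1), C n, fun n hn x => (hC n hn x).trans ?_⟩
    exact_mod_cast Finset.single_le_sum (f := C) (fun i _ => zero_le)
      (Finset.mem_range.mpr (by omega : n < k + 1))
  obtain ⟨C, hC⟩ := hC
  refine Ck.withSeminorms.continuous_of_continuous_comp _ fun p =>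
    Seminorm.continuous_of_le (q := C • p.1) ?_ fun e => ?_
  · exact p.2.const_smul C
  · refine Ck.seminorm_le p _ (apply_nonneg _ _) fun n hn x => ?_
    rw [hF.deriv_toLinearMap hab e hn, map_smul_eq_mul, RCLike.norm_ofReal]
    exact mul_le_mul_of_nonneg_right (hC n hn x) (apply_nonneg _ _)

/-- The continuous linear map `e ↦ (x ↦ F₀(x) e)` from `E` to `C^k([a,b], E)`. -/
def IsDerivChain.toCLM (hab : a < b) {F : ℕ → ℝ → ℝ} (hF : IsDerivChain a b k F) :
    E →L[𝕜] Ck 𝕜 E a b k := ⟨hF.toLinearMap, hF.continuous_toLinearMap hab⟩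

end Space

/-! ### Hat functions of a finite set of nodes. -/

section Hat

variable {T : Finset ℝ} {p x : ℝ}

theorem hat_eq_left {m : ℝ} (hm : IsGreatest {q : ℝ | q ∈ T ∧ q < p} m) (h1 : m ≤ x)
    (h2 : x ≤ p) : hat T p x = (x - m) / (p - m) := by
  rw [hat, hm.csSup_eq, if_pos ⟨⟨m, hm.1⟩, h1, h2⟩]

theorem hat_eq_right {s : ℝ} (hs : IsLeast {q : ℝ | q ∈ T ∧ p < q} s) (h1 : p ≤ x)
    (h2 : x ≤ s) : hat T p x = (s - x) / (s - p) := by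
  have hps : p < s := hs.1.2
  rw [hat, hs.csInf_eq]
  -- The left branch is tested first; it overlaps the right one only at `x = p`, where both give
  -- `1`.
  split_ifs with h h'
  · obtain rfl : x = p := le_antisymm h.2.2 h1
    have hlt : sSup {q : ℝ | q ∈ T ∧ q < x} < x := (Set.Nonempty.csSup_mem h.1 (T.finite_toSet.subset fun _ hq => hq.1)).2
    rw [div_self (sub_pos.mpr hlt).ne', div_self (sub_pos.mpr hps).ne']
  · rfl
  · exact absurd ⟨⟨s, hs.1⟩, h1, h2⟩ h'

theorem hat_eq_zero_of_le {m : ℝ} (hm : IsGreatest {q : ℝ | q ∈ T ∧ q < p} m) (h : x ≤ m) :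
    hat T p x = 0 := by
  have hmp : m < p := hm.1.2
  rcases h.eq_or_lt with rfl | h
  · rw [hat_eq_left hm le_rfl hmp.le, sub_self, zero_div]
  · rw [hat, hm.csSup_eq, if_neg fun h' => h.not_ge h'.2.1,
      if_neg fun h' => (h.trans hmp).not_ge h'.2.1]

theorem hat_eq_zero_of_ge {s : ℝ} (hs : IsLeast {q : ℝ | q ∈ T ∧ p < q} s) (h : s ≤ x) :
    hat T p x = 0 := by
  have hps : p < s := hs.1.2
  rcases h.eq_or_lt with rfl | h
  · rw [hat_eq_right hs hps.le le_rfl, sub_self, zero_div]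
  · rw [hat, hs.csInf_eq, if_neg fun h' => (hps.trans h).not_ge h'.2.2,
      if_neg fun h' => h.not_ge h'.2.2]

theorem exists_isGreatest_lt {q : ℝ} (hq : q ∈ T) (h : q < p) :
    ∃ m, IsGreatest {q : ℝ | q ∈ T ∧ q < p} m :=
  have hfin : {q : ℝ | q ∈ T ∧ q < p}.Finite := T.finite_toSet.subset fun _ hq => hq.1
  ⟨_, Set.Nonempty.csSup_mem ⟨q, hq, h⟩ hfin, fun _ h => le_csSup hfin.bddAbove h⟩

theorem exists_isLeast_gt {q : ℝ} (hq : q ∈ T) (h : p < q) :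
    ∃ s, IsLeast {q : ℝ | q ∈ T ∧ p < q} s :=
  have hfin : {q : ℝ | q ∈ T ∧ p < q}.Finite := T.finite_toSet.subset fun _ hq => hq.1
  ⟨_, Set.Nonempty.csInf_mem ⟨q, hq, h⟩ hfin, fun _ h => csInf_le hfin.bddBelow h⟩

theorem hat_self {q : ℝ} (hq : q ∈ T) (hqp : q ≠ p) : hat T p p = 1 := by
  rcases hqp.lt_or_gt with h | h
  · obtain ⟨m, hm⟩ := exists_isGreatest_lt hq h
    have hmp : m < p := hm.1.2
    rw [hat_eq_left hm hmp.le le_rfl, div_self (sub_pos.mpr hmp).ne']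
  · obtain ⟨s, hs⟩ := exists_isLeast_gt hq h
    have hps : p < s := hs.1.2
    rw [hat_eq_right hs le_rfl hps.le, div_self (sub_pos.mpr hps).ne']

theorem hat_of_mem_of_ne {q : ℝ} (hq : q ∈ T) (hqp : q ≠ p) : hat T p q = 0 := by
  rcases hqp.lt_or_gt with h | h
  · obtain ⟨m, hm⟩ := exists_isGreatest_lt hq h
    exact hat_eq_zero_of_le hm (hm.2 ⟨hq, h⟩)
  · obtain ⟨s, hs⟩ := exists_isLeast_gt hq h
    exact hat_eq_zero_of_ge hs (hs.2 ⟨hq, h⟩)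

variable {a b : ℝ}

/-- A hat function is affine on every interval without nodes in its interior. -/
theorem exists_hat_eq_affine (ha : a ∈ T) (hb : b ∈ T) (hp : p ∈ T) {u v : ℝ} (hau : a ≤ u)
    (huv : u < v) (hvb : v ≤ b) (hT : ∀ q ∈ T, q ≤ u ∨ v ≤ q) :
    ∃ α β : ℝ, ∀ x ∈ Icc u v, hat T p x = α + β * x := by
  -- If `p` lies left of the gap, its successor lies on one side of the gap too: the hat is then
  -- zero or its descending piece on `[u,v]`. The other case is symmetric.
  rcases hT p hp with hpu | hvp
  · obtain ⟨s, hs⟩ := exists_isLeast_gt hb (hpu.trans_lt (huv.trans_le hvb))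
    rcases hT s hs.1.1 with h | h
    · exact ⟨0, 0, fun x hx => by rw [hat_eq_zero_of_ge hs (h.trans hx.1)]; ring⟩
    · exact ⟨s / (s - p), -1 / (s - p), fun x hx => by
        rw [hat_eq_right hs (hpu.trans hx.1) (hx.2.trans h)]; ring⟩
  · obtain ⟨m, hm⟩ := exists_isGreatest_lt ha (hau.trans_lt (huv.trans_le hvp))
    rcases hT m hm.1.1 with h | h
    · exact ⟨-m / (p - m), 1 / (p - m), fun x hx => by
        rw [hat_eq_left hm (h.trans hx.1) (hx.2.trans hvp)]; ring⟩
    · exact ⟨0, 0, fun x hx => by rw [hat_eq_zero_of_le hm (hx.2.trans h)]; ring⟩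

theorem continuousOn_hat (ha : a ∈ T) (hb : b ∈ T) (hp : p ∈ Icc a b) :
    ContinuousOn (hat T p) (Icc a b) := by
  have h1 : ContinuousOn (hat T p) (Icc a p) := by
    rcases hp.1.eq_or_lt with rfl | h
    · rw [Icc_self]
      exact continuousOn_singleton _ _
    · obtain ⟨m, hm⟩ := exists_isGreatest_lt ha h
      rw [← Icc_union_Icc_eq_Icc (hm.2 ⟨ha, h⟩) (show m ≤ p from hm.1.2.le)]
      refine ContinuousOn.union_of_isClosed ?_ ?_ isClosed_Icc isClosed_Icc
      · exact continuousOn_const.congr fun x hx => hat_eq_zero_of_le hm hx.2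
      · exact ContinuousOn.congr (by fun_prop : ContinuousOn (fun x => (x - m) / (p - m)) _)
          fun x hx => hat_eq_left hm hx.1 hx.2
  have h2 : ContinuousOn (hat T p) (Icc p b) := by
    rcases hp.2.eq_or_lt with rfl | h
    · rw [Icc_self]
      exact continuousOn_singleton _ _
    · obtain ⟨s, hs⟩ := exists_isLeast_gt hb h
      rw [← Icc_union_Icc_eq_Icc (show p ≤ s from hs.1.2.le) (hs.2 ⟨hb, h⟩)]
      refine ContinuousOn.union_of_isClosed ?_ ?_ isClosed_Icc isClosed_Icc
      · exact ContinuousOn.congr (by fun_prop : ContinuousOn (fun x => (s - x) / (s - p)) _)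
          fun x hx => hat_eq_right hs hx.1 hx.2
      · exact continuousOn_const.congr fun x hx => hat_eq_zero_of_ge hs hx.1
  rw [← Icc_union_Icc_eq_Icc hp.1 hp.2]
  exact h1.union_of_isClosed h2 isClosed_Icc isClosed_Icc

end Hat

/-! ### Schauder hats, their coefficients, and uniform convergence of the interpolants. -/

section SchauderHat

variable {a b : ℝ} {t : ℕ → Icc a b}

theorem mem_nodes {n : ℕ} {q : ℝ} : q ∈ nodes t n ↔ ∃ j ≤ n, (t j : ℝ) = q := by
  simp [nodes]

/-- Uniform description of all hats: `max n 1` accounts for `φ_0`, which belongs to `T^1`. -/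
theorem schauderHat_eq_hat (n : ℕ) : schauderHat t n = hat (nodes t (max n 1)) (t n) := by
  match n with
  | 0 => rfl
  | 1 => rfl
  | n + 2 => rw [schauderHat, max_eq_left (by omega)]

theorem schauderHat_self (htinj : Function.Injective t) (n : ℕ) : schauderHat t n (t n) = 1 := by
  rw [schauderHat_eq_hat]
  refine hat_self (q := t (if n = 0 then 1 else 0)) (mem_nodes.mpr ⟨_, ?_, rfl⟩) fun h => ?_
  · split_ifs <;> omega
  · have := htinj (Subtype.ext h)
    split_ifs at this <;> omega

theorem schauderHat_of_ne (htinj : Function.Injective t) {n i : ℕ} (hi : i ≤ max n 1)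
    (hne : i ≠ n) : schauderHat t n (t i) = 0 := by
  rw [schauderHat_eq_hat]
  exact hat_of_mem_of_ne (mem_nodes.mpr ⟨i, hi, rfl⟩) fun h => hne (htinj (Subtype.ext h))

theorem left_mem_nodes (ht0 : (t 0 : ℝ) = a) (n : ℕ) : a ∈ nodes t n :=
  mem_nodes.mpr ⟨0, by omega, ht0⟩

theorem right_mem_nodes (ht1 : (t 1 : ℝ) = b) {n : ℕ} (hn : 1 ≤ n) : b ∈ nodes t n :=
  mem_nodes.mpr ⟨1, hn, ht1⟩

theorem continuousOn_schauderHat (ht0 : (t 0 : ℝ) = a) (ht1 : (t 1 : ℝ) = b) (n : ℕ) :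
    ContinuousOn (schauderHat t n) (Icc a b) := by
  rw [schauderHat_eq_hat]
  exact continuousOn_hat (left_mem_nodes ht0 _) (right_mem_nodes ht1 (le_max_right _ _)) (t n).2

/-- On an interval without nodes in its interior, a Schauder hat function is given by linear
interpolation. -/
theorem schauderHat_eq_interp (ht0 : (t 0 : ℝ) = a) (ht1 : (t 1 : ℝ) = b) {n l : ℕ} (hl : 1 ≤ l)
    (hn : n ≤ l) {u v x : ℝ} (hau : a ≤ u) (hux : u < x) (hxv : x < v) (hvb : v ≤ b)
    (hT : ∀ q ∈ nodes t l, q ≤ u ∨ v ≤ q) :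
    schauderHat t n x = (v - x) / (v - u) * schauderHat t n u +
      (x - u) / (v - u) * schauderHat t n v := by
  have hsub : ∀ q ∈ nodes t (max n 1), q ∈ nodes t l := fun q hq => by
    obtain ⟨j, hj, h⟩ := mem_nodes.mp hq
    exact mem_nodes.mpr ⟨j, hj.trans (max_le hn hl), h⟩
  obtain ⟨α, β, h⟩ := exists_hat_eq_affine (left_mem_nodes ht0 (max n 1))
    (right_mem_nodes ht1 (le_max_right n 1)) (mem_nodes.mpr ⟨n, le_max_left n 1, rfl⟩)
    hau (hux.trans hxv) hvb fun q hq => hT q (hsub q hq)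
  have huv : v - u ≠ 0 := (sub_pos.mpr (hux.trans hxv)).ne'
  rw [schauderHat_eq_hat, h x ⟨hux.le, hxv.le⟩, h u ⟨le_rfl, (hux.trans hxv).le⟩,
    h v ⟨(hux.trans hxv).le, le_rfl⟩]
  field_simp
  ring

variable (𝕜 : Type*) [RCLike 𝕜] {E : Type*} [AddCommGroup E] [Module 𝕜 E]

/-- One recursion for all `n`, suited to strong induction; for `n = 1` it agrees with the definition
because `φ_0(t_1) = 0`. -/
theorem hatCoeff_eq (htinj : Function.Injective t) (g : Icc a b → E) (n : ℕ) :
    hatCoeff 𝕜 t g n = g (t n) -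
      ∑ j ∈ Finset.range n, ((schauderHat t j (t n) : ℝ) : 𝕜) • hatCoeff 𝕜 t g j := by
  match n with
  | 0 => rw [hatCoeff]; simp
  | 1 => rw [hatCoeff]; simp [schauderHat_of_ne htinj (n := 0) (i := 1) (by simp) (by simp)]
  | n + 2 =>
    rw [hatCoeff, Finset.sum_range fun j => ((schauderHat t j (t (n + 2)) : ℝ) : 𝕜) •
      hatCoeff 𝕜 t g j]

/-- Hats of index above `i` vanish at `t_i`, and `φ_i(t_i) = 1`, so the recursion for `λ_i`
collapses the sum. -/
theorem sum_schauderHat_smul_hatCoeff (htinj : Function.Injective t) (g : Icc a b → E) {i l : ℕ}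
    (hi : i ≤ l) :
    ∑ j ∈ Finset.range (l + 1), ((schauderHat t j (t i) : ℝ) : 𝕜) • hatCoeff 𝕜 t g j =
      g (t i) := by
  have hsub : Finset.range (i + 1) ⊆ Finset.range (l + 1) := by
    simpa using hi
  rw [← Finset.sum_subset hsub, Finset.sum_range_succ, schauderHat_self htinj,
    hatCoeff_eq 𝕜 htinj g i]
  · simp
  · intro j _ hj
    rw [Finset.mem_range] at hj
    rw [schauderHat_of_ne htinj (by omega) (by omega)]
    simp

theorem hatCoeff_add (htinj : Function.Injective t) (g g' : Icc a b → E) (n : ℕ) :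
    hatCoeff 𝕜 t (g + g') n = hatCoeff 𝕜 t g n + hatCoeff 𝕜 t g' n := by
  induction n using Nat.strong_induction_on with
  | _ n ih =>
    rw [hatCoeff_eq 𝕜 htinj, hatCoeff_eq 𝕜 htinj g, hatCoeff_eq 𝕜 htinj g', Pi.add_apply,
      Finset.sum_congr rfl fun j hj => by rw [ih j (Finset.mem_range.mp hj), smul_add],
      Finset.sum_add_distrib]
    abel

theorem hatCoeff_smul (htinj : Function.Injective t) (c : 𝕜) (g : Icc a b → E) (n : ℕ) :
    hatCoeff 𝕜 t (c • g) n = c • hatCoeff 𝕜 t g n := by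
  induction n using Nat.strong_induction_on with
  | _ n ih =>
    rw [hatCoeff_eq 𝕜 htinj, hatCoeff_eq 𝕜 htinj g, Pi.smul_apply,
      Finset.sum_congr rfl fun j hj => by rw [ih j (Finset.mem_range.mp hj), smul_comm],
      ← Finset.smul_sum, smul_sub]

theorem hatCoeff_zero (htinj : Function.Injective t) (n : ℕ) :
    hatCoeff 𝕜 t (0 : Icc a b → E) n = 0 := by
  simpa using hatCoeff_smul 𝕜 htinj 0 (0 : Icc a b → E) n

theorem hatCoeff_schauderHat_smul (htinj : Function.Injective t) (m : ℕ) (e : E) (n : ℕ) :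
    hatCoeff 𝕜 t (fun x => ((schauderHat t m x : ℝ) : 𝕜) • e) n = if n = m then e else 0 := by
  induction n using Nat.strong_induction_on with
  | _ n ih =>
    rw [hatCoeff_eq 𝕜 htinj, Finset.sum_congr rfl fun j hj => by
      rw [ih j (Finset.mem_range.mp hj), smul_ite, smul_zero], Finset.sum_ite_eq']
    rcases lt_trichotomy n m with h | rfl | h
    · rw [schauderHat_of_ne htinj (by omega) h.ne, if_neg (by simpa using h.le), if_neg h.ne]
      simp
    · simp [schauderHat_self htinj]
    · simp [h, h.ne']

/-- Each coefficient involves finitely many point values, so pointwise continuity in the parameter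
is enough. -/
theorem continuous_hatCoeff {F : Type*} [TopologicalSpace F] [TopologicalSpace E]
    [IsTopologicalAddGroup E] [ContinuousSMul 𝕜 E] (htinj : Function.Injective t)
    {G : F → Icc a b → E} (hG : ∀ x, Continuous fun f => G f x) (n : ℕ) :
    Continuous fun f => hatCoeff 𝕜 t (G f) n := by
  induction n using Nat.strong_induction_on with
  | _ n ih =>
    simp_rw [hatCoeff_eq 𝕜 htinj (G _) n]
    exact (hG _).sub (continuous_finsetSum _ fun j hj =>
      (ih j (Finset.mem_range.mp hj)).const_smul _)

theorem exists_forall_exists_dist_lt (ht : DenseRange t) {δ : ℝ} (hδ : 0 < δ) :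
    ∃ L : ℕ, ∀ y : Icc a b, ∃ i ≤ L, dist y (t i) < δ := by
  obtain ⟨s, hs⟩ := isCompact_univ.elim_finite_subcover (fun i => Metric.ball (t i) δ)
    (fun i => Metric.isOpen_ball) fun y _ => by
      obtain ⟨i, hi⟩ := ht.exists_dist_lt y hδ
      exact mem_iUnion.mpr ⟨i, hi⟩
  refine ⟨s.sup id, fun y => ?_⟩
  obtain ⟨i, hi, h⟩ := mem_iUnion₂.mp (hs (mem_univ y))
  exact ⟨i, Finset.le_sup (f := id) hi, h⟩

/-- The piecewise linear interpolations of a continuous function at the nodes `t 0, …, t l`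
converge to it uniformly with respect to every continuous seminorm. -/
theorem exists_forall_seminorm_sub_sum_le [TopologicalSpace E] [IsTopologicalAddGroup E]
    (ht : DenseRange t) (ht0 : (t 0 : ℝ) = a) (ht1 : (t 1 : ℝ) = b)
    (htinj : Function.Injective t) (p : Seminorm 𝕜 E) (hp : Continuous p) (g : C(Icc a b, E))
    {ε : ℝ} (hε : 0 < ε) :
    ∃ L : ℕ, ∀ l ≥ L, ∀ x : Icc a b, p (g x -
      ∑ j ∈ Finset.range (l + 1), ((schauderHat t j x : ℝ) : 𝕜) • hatCoeff 𝕜 t g j) ≤ ε := by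
  -- Uniform continuity is applied to this real function on the compact square and compared with its
  -- zero values on the diagonal.
  have hcont : Continuous fun q : Icc a b × Icc a b => p (g q.1 - g q.2) := by fun_prop
  obtain ⟨δ, hδ, hg⟩ := Metric.uniformContinuous_iff.mp
    (CompactSpace.uniformContinuous_of_continuous hcont) ε hε
  have hg' : ∀ x y : Icc a b, dist y x < δ → p (g x - g y) ≤ ε := fun x y hxy => by
    have := hg (a := (x, y)) (b := (x, x)) (by rwa [Prod.dist_eq, dist_self, max_eq_right dist_nonneg])
    rw [sub_self, map_zero, dist_zero_right, Real.norm_eq_abs] at this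
    exact (le_abs_self _).trans this.le
  obtain ⟨L, hL⟩ := exists_forall_exists_dist_lt ht (half_pos hδ)
  -- Index at least `1`, so that `b` is a node.
  refine ⟨max L 1, fun l hl x => ?_⟩
  have hLl : L ≤ l := (le_max_left _ _).trans hl
  have h1l : 1 ≤ l := (le_max_right _ _).trans hl
  by_cases hx : (x : ℝ) ∈ nodes t l
  · obtain ⟨i, hi, h⟩ := mem_nodes.mp hx
    obtain rfl : t i = x := Subtype.ext h
    rw [sum_schauderHat_smul_hatCoeff 𝕜 htinj g hi, sub_self, map_zero]
    exact hε.le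
  have hax : a < x := x.2.1.lt_of_ne fun h => hx (h ▸ left_mem_nodes ht0 l)
  have hxb : (x : ℝ) < b := x.2.2.lt_of_ne fun h => hx (by rw [h]; exact right_mem_nodes ht1 h1l)
  obtain ⟨u, hu⟩ := exists_isGreatest_lt (left_mem_nodes ht0 l) hax
  obtain ⟨v, hv⟩ := exists_isLeast_gt (right_mem_nodes ht1 h1l) hxb
  have hT : ∀ q ∈ nodes t l, q ≤ u ∨ v ≤ q := fun q hq => by
    rcases lt_trichotomy q x with h | rfl | h
    · exact .inl (hu.2 ⟨hq, h⟩)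
    · exact absurd hq hx
    · exact .inr (hv.2 ⟨hq, h⟩)
  obtain ⟨⟨hu1, hux⟩, -⟩ := hu
  obtain ⟨⟨hv1, hxv⟩, -⟩ := hv
  obtain ⟨i, hi, rfl⟩ := mem_nodes.mp hu1
  obtain ⟨j, hj, rfl⟩ := mem_nodes.mp hv1
  -- The midpoint of a gap of length at least `δ` would have distance at least `δ / 2` from every
  -- node.
  have hmesh : (t j : ℝ) - t i < δ := by
    by_contra! hcon
    obtain ⟨m, hm, hd⟩ := hL ⟨((t i : ℝ) + t j) / 2, by
      constructor <;> linarith [(t i).2.1, (t i).2.2, (t j).2.1, (t j).2.2]⟩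
    rw [Subtype.dist_eq, Real.dist_eq, abs_lt] at hd
    rcases hT (t m) (mem_nodes.mpr ⟨m, hm.trans hLl, rfl⟩) with h | h
    · linarith
    · linarith
  set r : ℝ := (t j - x) / (t j - t i)
  set s : ℝ := (x - t i) / (t j - t i)
  have hpos : (0 : ℝ) < t j - t i := sub_pos.mpr (hux.trans hxv)
  have hr : 0 ≤ r := div_nonneg (sub_pos.mpr hxv).le hpos.le
  have hs : 0 ≤ s := div_nonneg (sub_pos.mpr hux).le hpos.le
  have hrs : r + s = 1 := by
    rw [← add_div, div_eq_one_iff_eq hpos.ne']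
    ring
  -- Every hat involved is affine on the gap, so the sum at `x` is the convex combination of its
  -- values at the two ends, which are values of `g`.
  have hsum : ∑ n ∈ Finset.range (l + 1), ((schauderHat t n x : ℝ) : 𝕜) • hatCoeff 𝕜 t g n =
      (r : 𝕜) • g (t i) + (s : 𝕜) • g (t j) := by
    rw [← sum_schauderHat_smul_hatCoeff 𝕜 htinj g hi, ← sum_schauderHat_smul_hatCoeff 𝕜 htinj g hj,
      Finset.smul_sum, Finset.smul_sum, ← Finset.sum_add_distrib]
    refine Finset.sum_congr rfl fun n hn => ?_
    rw [schauderHat_eq_interp ht0 ht1 h1l (Nat.lt_succ_iff.mp (Finset.mem_range.mp hn))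
      (t i).2.1 hux hxv (t j).2.2 hT, smul_smul, smul_smul, ← add_smul]
    simp only [RCLike.ofReal_add, RCLike.ofReal_mul]
    rfl
  have hrs' : (r : 𝕜) + (s : 𝕜) = 1 := by exact_mod_cast congrArg ((↑) : ℝ → 𝕜) hrs
  have hdiff : g x - ((r : 𝕜) • g (t i) + (s : 𝕜) • g (t j)) =
      (r : 𝕜) • (g x - g (t i)) + (s : 𝕜) • (g x - g (t j)) := by
    rw [smul_sub, smul_sub, sub_add_sub_comm, ← add_smul, hrs', one_smul]
  have hi' : p (g x - g (t i)) ≤ ε := hg' _ _ <| by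
    rw [Subtype.dist_eq, Real.dist_eq, abs_lt]
    constructor <;> linarith
  have hj' : p (g x - g (t j)) ≤ ε := hg' _ _ <| by
    rw [Subtype.dist_eq, Real.dist_eq, abs_lt]
    constructor <;> linarith
  rw [hsum, hdiff]
  calc p _ ≤ r * p (g x - g (t i)) + s * p (g x - g (t j)) := by
        refine (map_add_le_add p _ _).trans_eq ?_
        rw [map_smul_eq_mul, map_smul_eq_mul, RCLike.norm_ofReal, RCLike.norm_ofReal,
          abs_of_nonneg hr, abs_of_nonneg hs]
    _ ≤ r * ε + s * ε := by gcongr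
    _ = ε := by rw [← add_mul, hrs, one_mul]

end SchauderHat

/-! ### Iterated primitives and the derivatives of the basis functions. -/

section Primitive

variable {a b : ℝ}

theorem continuousOn_iterate_primitive (hab : a ≤ b) {g : ℝ → ℝ} (hg : ContinuousOn g (Icc a b))
    (j : ℕ) :
    ContinuousOn ((fun g : ℝ → ℝ => fun x => ∫ s in a..x, g s)^[j] g) (Icc a b) := by
  induction j with
  | zero => exact hg
  | succ j ih =>
    rw [Function.iterate_succ_apply']
    rw [← uIcc_of_le hab] at ih ⊢
    exact intervalIntegral.continuousOn_primitive_interval' ih.intervalIntegrable left_mem_uIcc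

theorem hasDerivAt_iterate_primitive {g : ℝ → ℝ} (hg : ContinuousOn g (Icc a b))
    (j : ℕ) {x : ℝ} (hx : x ∈ Ioo a b) :
    HasDerivAt ((fun g : ℝ → ℝ => fun x => ∫ s in a..x, g s)^[j + 1] g)
      ((fun g : ℝ → ℝ => fun x => ∫ s in a..x, g s)^[j] g x) x := by
  have hc := continuousOn_iterate_primitive (hx.1.trans hx.2).le hg j
  rw [Function.iterate_succ_apply']
  refine intervalIntegral.integral_hasDerivAt_right ?_
    ((hc.mono Ioo_subset_Icc_self).stronglyMeasurableAtFilter isOpen_Ioo x hx)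
    (hc.continuousAt (Icc_mem_nhds hx.1 hx.2))
  refine (hc.mono ?_).intervalIntegrable
  rw [uIcc_of_le hx.1.le]
  exact Icc_subset_Icc_right hx.2.le

variable {t : ℕ → Icc a b}

/-- The derivatives of order `m ≤ k` of the basis functions. -/
def basisDeriv (k : ℕ) (t : ℕ → Icc a b) (n m : ℕ) : ℝ → ℝ :=
  if n < k then fun x => if m ≤ n then (x - a) ^ (n - m) / ((n - m).factorial : ℝ) else 0
  else (fun g : ℝ → ℝ => fun x => ∫ s in a..x, g s)^[k - m] (schauderHat t (n - k))

theorem basisDeriv_zero (k n : ℕ) : basisDeriv k t n 0 = basisFn k t n := by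
  simp [basisDeriv, basisFn]

theorem isDerivChain_basisDeriv (hab : a < b) (ht0 : (t 0 : ℝ) = a) (ht1 : (t 1 : ℝ) = b)
    (k n : ℕ) : IsDerivChain a b k (basisDeriv k t n) := by
  have hg := continuousOn_schauderHat ht0 ht1 (n - k)
  by_cases hn : n < k
  · refine ⟨fun m hm x hx => ?_, fun m hm => ?_⟩
    · simp only [basisDeriv, if_pos hn]
      rcases lt_trichotomy m n with h | rfl | h
      · obtain ⟨j, rfl⟩ : ∃ j, n = m + 1 + j := ⟨n - (m + 1), by omega⟩
        simp only [show m ≤ m + 1 + j by omega, show m + 1 ≤ m + 1 + j by omega, if_true,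
          show m + 1 + j - m = j + 1 by omega, show m + 1 + j - (m + 1) = j by omega]
        refine ((((hasDerivAt_id x).sub_const a).pow (j + 1)).div_const _).congr_deriv ?_
        have : (j.factorial : ℝ) ≠ 0 := by positivity
        rw [Nat.factorial_succ]
        push_cast
        simp only [id]
        field_simp
      · simpa using hasDerivAt_const x (1 : ℝ)
      · simpa [show ¬ m ≤ n by omega, show ¬ m + 1 ≤ n by omega] using hasDerivAt_const x (0 : ℝ)
    · simp only [basisDeriv, if_pos hn]
      split_ifs
      · fun_prop
      · fun_prop
  · refine ⟨fun m hm x hx => ?_, fun m hm => ?_⟩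
    · obtain ⟨j, rfl⟩ : ∃ j, k = m + 1 + j := ⟨k - (m + 1), by omega⟩
      simp only [basisDeriv, if_neg hn]
      rw [show m + 1 + j - m = j + 1 by omega, show m + 1 + j - (m + 1) = j by omega]
      exact hasDerivAt_iterate_primitive hg j hx
    · simp only [basisDeriv, if_neg hn]
      exact continuousOn_iterate_primitive hab.le hg _

/-- For `n ≥ k` at least one integration remains, and it runs from `a` to `a`. -/
theorem basisDeriv_left {k m : ℕ} (hm : m < k) (n : ℕ) :
    basisDeriv k t n m a = if m = n then 1 else 0 := by
  by_cases hn : n < k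
  · simp only [basisDeriv, if_pos hn, sub_self]
    rcases lt_trichotomy m n with h | rfl | h
    · rw [if_pos h.le, if_neg h.ne, zero_pow (by omega), zero_div]
    · simp
    · rw [if_neg h.not_ge, if_neg h.ne']
  · obtain ⟨j, hj⟩ : ∃ j, k - m = j + 1 := ⟨k - m - 1, by omega⟩
    rw [basisDeriv, if_neg hn, hj, Function.iterate_succ_apply', if_neg (by omega)]
    exact intervalIntegral.integral_same

theorem basisDeriv_self_of_lt {k n : ℕ} (hn : n < k) (x : ℝ) : basisDeriv k t n k x = 0 := by
  simp [basisDeriv, hn, hn.not_ge]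

theorem basisDeriv_self_add (k n : ℕ) : basisDeriv k t (k + n) k = schauderHat t n := by
  simp [basisDeriv]

end Primitive

/-! ### Biorthogonality, projections and convergence. -/

section Decomposition

variable {𝕜 : Type*} [RCLike 𝕜] {E : Type*} [AddCommGroup E] [Module 𝕜 E] [TopologicalSpace E]
  [IsTopologicalAddGroup E] [ContinuousSMul 𝕜 E] [T2Space E] {a b : ℝ} {t : ℕ → Icc a b} {k : ℕ}

/-- The coefficients `μ_n` as linear maps. -/
def coeffLinearMap (hab : a < b) (htinj : Function.Injective t) (k n : ℕ) :
    Ck 𝕜 E a b k →ₗ[𝕜] E where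
  toFun := coeff hab t n
  map_add' f g := by
    unfold coeff
    split_ifs with hn
    · rw [Ck.deriv_add hab f g hn.le, ContinuousMap.add_apply]
    · rw [Ck.deriv_add hab f g le_rfl, ContinuousMap.coe_add, hatCoeff_add 𝕜 htinj]
  map_smul' c f := by
    unfold coeff
    split_ifs with hn
    · rw [Ck.deriv_smul hab c f hn.le, ContinuousMap.smul_apply, RingHom.id_apply]
    · rw [Ck.deriv_smul hab c f le_rfl, ContinuousMap.coe_smul, hatCoeff_smul 𝕜 htinj,
        RingHom.id_apply]

theorem continuous_coeff [PolynormableSpace 𝕜 E] (hab : a < b) (htinj : Function.Injective t)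
    (k n : ℕ) : Continuous (coeff hab t n : Ck 𝕜 E a b k → E) := by
  by_cases hn : n < k
  · rw [show (coeff hab t n : Ck 𝕜 E a b k → E) = _ from funext fun f => if_pos hn]
    exact Ck.continuous_deriv_apply hab hn.le _
  · rw [show (coeff hab t n : Ck 𝕜 E a b k → E) = _ from funext fun f => if_neg hn]
    exact continuous_hatCoeff 𝕜 htinj (fun x => Ck.continuous_deriv_apply hab le_rfl x) _

section

variable (hab : a < b) (ht0 : (t 0 : ℝ) = a) (ht1 : (t 1 : ℝ) = b)

theorem deriv_toCLM_basisDeriv (n : ℕ) (e : E) {m : ℕ} (hm : m ≤ k) (x : Icc a b) :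
    ((isDerivChain_basisDeriv hab ht0 ht1 k n).toCLM (𝕜 := 𝕜) hab e).deriv m x =
      ((basisDeriv k t n m x : ℝ) : 𝕜) • e :=
  (isDerivChain_basisDeriv hab ht0 ht1 k n).deriv_toLinearMap hab e hm x

/-- Below order `k` this is evaluation of derivatives at `a`; from `k` on, the `k`-th derivative
kills the monomials and turns the other basis functions back into hats. -/
theorem coeff_toCLM_basisDeriv (htinj : Function.Injective t) (m n : ℕ) (e : E) :
    coeff hab t m ((isDerivChain_basisDeriv hab ht0 ht1 k n).toCLM (𝕜 := 𝕜) hab e) =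
      if m = n then e else 0 := by
  unfold coeff
  split_ifs with hm h h
  · rw [deriv_toCLM_basisDeriv hab ht0 ht1 n e hm.le, basisDeriv_left hm, if_pos h,
      RCLike.ofReal_one, one_smul]
  · rw [deriv_toCLM_basisDeriv hab ht0 ht1 n e hm.le, basisDeriv_left hm, if_neg h,
      RCLike.ofReal_zero, zero_smul]
  all_goals
    rw [show ⇑(((isDerivChain_basisDeriv hab ht0 ht1 k n).toCLM (𝕜 := 𝕜) hab e).deriv k) = _ from
      funext fun x => deriv_toCLM_basisDeriv hab ht0 ht1 n e le_rfl x]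
  · obtain ⟨j, rfl⟩ : ∃ j, n = k + j := ⟨n - k, by omega⟩
    rw [basisDeriv_self_add, hatCoeff_schauderHat_smul 𝕜 htinj, if_pos (by omega)]
  · rcases lt_or_ge n k with hn | hn
    · simp_rw [basisDeriv_self_of_lt hn, RCLike.ofReal_zero, zero_smul]
      exact hatCoeff_zero 𝕜 htinj _
    · obtain ⟨j, rfl⟩ : ∃ j, n = k + j := ⟨n - k, by omega⟩
      rw [basisDeriv_self_add, hatCoeff_schauderHat_smul 𝕜 htinj, if_neg (by omega)]

end

variable [PolynormableSpace 𝕜 E]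

/-- The continuous linear operators `f ↦ μ_n(f) f_n`. -/
def expansionTerm (hab : a < b) (ht0 : (t 0 : ℝ) = a) (ht1 : (t 1 : ℝ) = b)
    (htinj : Function.Injective t) (k n : ℕ) : Ck 𝕜 E a b k →L[𝕜] Ck 𝕜 E a b k :=
  ((isDerivChain_basisDeriv hab ht0 ht1 k n).toCLM hab).comp
    ⟨coeffLinearMap hab htinj k n, continuous_coeff hab htinj k n⟩

variable (hab : a < b) (ht0 : (t 0 : ℝ) = a) (ht1 : (t 1 : ℝ) = b)
  (htinj : Function.Injective t)

theorem expansionTerm_eq (n : ℕ) (f : Ck 𝕜 E a b k) :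
    expansionTerm hab ht0 ht1 htinj k n f =
      (isDerivChain_basisDeriv hab ht0 ht1 k n).toCLM hab (coeff hab t n f) := rfl

theorem expansionTerm_apply (n : ℕ) (f : Ck 𝕜 E a b k) (x : Ioo a b) :
    expansionTerm hab ht0 ht1 htinj k n f x =
      ((basisFn k t n x : ℝ) : 𝕜) • coeff hab t n f := by
  rw [← basisDeriv_zero]
  rfl

theorem expansionTerm_expansionTerm (m n : ℕ) (f : Ck 𝕜 E a b k) :
    expansionTerm hab ht0 ht1 htinj k m (expansionTerm hab ht0 ht1 htinj k n f) =
      if m = n then expansionTerm hab ht0 ht1 htinj k m f else 0 := by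
  rw [expansionTerm_eq _ _ _ _ m, expansionTerm_eq _ _ _ _ n,
    coeff_toCLM_basisDeriv hab ht0 ht1 htinj m n]
  split_ifs with h
  · rw [h]
    rfl
  · exact map_zero _

theorem sum_expansionTerm_comp (i j : ℕ) :
    (∑ n ∈ Finset.range (i + 1), expansionTerm (𝕜 := 𝕜) (E := E) hab ht0 ht1 htinj k n).comp
      (∑ n ∈ Finset.range (j + 1), expansionTerm hab ht0 ht1 htinj k n) =
      ∑ n ∈ Finset.range (min i j + 1), expansionTerm hab ht0 ht1 htinj k n := by
  refine ContinuousLinearMap.ext fun f => ?_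
  simp only [ContinuousLinearMap.comp_apply, _root_.sum_apply, map_sum,
    expansionTerm_expansionTerm, Finset.sum_ite_eq']
  rw [← Finset.sum_filter]
  refine Finset.sum_congr (Finset.ext fun n => ?_) fun _ _ => rfl
  simp only [Finset.mem_filter, Finset.mem_range]
  omega

/-- The function `f_j e` with `e ≠ 0` is killed by the shorter sum and fixed by the longer one;
`μ_j` detects this. -/
theorem sum_expansionTerm_ne [Nontrivial E] {i j : ℕ} (hij : i < j) :
    ∑ n ∈ Finset.range (i + 1), expansionTerm (𝕜 := 𝕜) (E := E) hab ht0 ht1 htinj k n ≠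
      ∑ n ∈ Finset.range (j + 1), expansionTerm hab ht0 ht1 htinj k n := by
  intro h
  obtain ⟨e, he⟩ := exists_ne (0 : E)
  have h' := congrArg (coeff hab t j) (DFunLike.congr_fun h
    ((isDerivChain_basisDeriv hab ht0 ht1 k j).toCLM hab e))
  simp only [_root_.sum_apply, expansionTerm_eq,
    coeff_toCLM_basisDeriv hab ht0 ht1 htinj, apply_ite (_ : E → Ck 𝕜 E a b k), map_zero,
    Finset.sum_ite_eq'] at h'
  rw [if_neg (by rw [Finset.mem_range]; omega), if_pos (by simp),
    coeff_toCLM_basisDeriv hab ht0 ht1 htinj, if_pos rfl] at h'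
  exact he (h'.symm.trans (map_zero (coeffLinearMap hab htinj k j)))

theorem deriv_sub_sum_expansionTerm (f : Ck 𝕜 E a b k) (s : Finset ℕ) {m : ℕ} (hm : m ≤ k)
    (x : Icc a b) :
    (f - ∑ n ∈ s, expansionTerm hab ht0 ht1 htinj k n f).deriv m x =
      f.deriv m x - ∑ n ∈ s, ((basisDeriv k t n m x : ℝ) : 𝕜) • coeff hab t n f := by
  rw [Ck.deriv_sub hab _ _ hm]
  congr 1
  refine (map_sum (Ck.derivAt hab hm x) _ s).trans (Finset.sum_congr rfl fun n _ => ?_)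
  exact deriv_toCLM_basisDeriv hab ht0 ht1 n _ hm x

theorem tendsto_sum_expansionTerm (ht : DenseRange t) (f : Ck 𝕜 E a b k) :
    Tendsto (fun l => ∑ n ∈ Finset.range (l + 1), expansionTerm hab ht0 ht1 htinj k n f) atTop
      (𝓝 f) := by
  rw [Ck.withSeminorms.tendsto_nhds]
  intro p ε hε
  have hC : 0 < (1 + (b - a)) ^ k := by
    have := sub_pos.mpr hab
    positivity
  -- The power cancels the constant of `Ck.seminorm_le_of_deriv_le`; the half makes the final
  -- inequality strict.
  obtain ⟨L, hL⟩ := exists_forall_seminorm_sub_sum_le 𝕜 ht ht0 ht1 htinj p.1 p.2 (f.deriv k)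
    (ε := ε / 2 / (1 + (b - a)) ^ k) (by positivity)
  -- The first `k` terms are the Taylor terms; with `l = k + j` the remaining ones are the hats `0,
  -- …, j`, and `j ≥ L`.
  filter_upwards [eventually_ge_atTop (k + L)] with l hl
  obtain ⟨j, rfl⟩ : ∃ j, l = k + j := ⟨l - k, by omega⟩
  rw [map_sub_rev]
  refine (Ck.seminorm_le_of_deriv_le hab p _ (fun m hm => ?_) (by positivity)
    (fun x => ?_)).trans_lt (?_ : ε / 2 / (1 + (b - a)) ^ k * (1 + (b - a)) ^ k < ε)
  · rw [deriv_sub_sum_expansionTerm _ _ _ _ _ _ hm.le, Finset.sum_eq_single_of_mem m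
      (Finset.mem_range.mpr (by omega)) fun n _ hn => by
        rw [basisDeriv_left hm, if_neg hn.symm, RCLike.ofReal_zero, zero_smul],
      basisDeriv_left hm, if_pos rfl, RCLike.ofReal_one, one_smul, coeff, if_pos hm, sub_self]
  · rw [deriv_sub_sum_expansionTerm _ _ _ _ _ _ le_rfl, add_assoc, Finset.sum_range_add,
      Finset.sum_eq_zero fun n hn => by
        rw [basisDeriv_self_of_lt (Finset.mem_range.mp hn), RCLike.ofReal_zero, zero_smul],
      zero_add]
    convert! hL j (by omega) x using 5 with n hn
    · rw [basisDeriv_self_add]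
    · simp [coeff]
  · rw [div_mul_cancel₀ _ hC.ne']
    exact half_lt_self hε

end Decomposition

end

end CkInterval

theorem theorem4p4 {𝕜 : Type*} [RCLike 𝕜] {E : Type*} [AddCommGroup E] [Module 𝕜 E]
    [TopologicalSpace E] [IsTopologicalAddGroup E] [ContinuousSMul 𝕜 E] [PolynormableSpace 𝕜 E]
    [T2Space E] [Nontrivial E] (hE : CkInterval.MetricCCP 𝕜 E)
    {a b : ℝ} (hab : a < b) (k : ℕ) (hk : 1 ≤ k)
    (t : ℕ → Set.Icc a b) (ht : DenseRange t) (ht0 : (t 0 : ℝ) = a) (ht1 : (t 1 : ℝ) = b)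
    (htinj : Function.Injective t) :
    ∃ Q : ℕ → CkInterval.Ck 𝕜 E a b k →L[𝕜] CkInterval.Ck 𝕜 E a b k,
      (∀ (n : ℕ) (f : CkInterval.Ck 𝕜 E a b k) (x : Set.Ioo a b),
        Q n f x = ((CkInterval.basisFn k t n x : ℝ) : 𝕜) • CkInterval.coeff hab t n f) ∧
      CkInterval.IsSchauderDecomposition (fun l => ∑ n ∈ Finset.range (l + 1), Q n) ∧
      ∀ f : CkInterval.Ck 𝕜 E a b k,
        Tendsto (fun l => ∑ n ∈ Finset.range (l + 1), Q n f) atTop (𝓝 f) := by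
  refine ⟨CkInterval.expansionTerm hab ht0 ht1 htinj k,
    CkInterval.expansionTerm_apply hab ht0 ht1 htinj,
    ⟨CkInterval.sum_expansionTerm_comp hab ht0 ht1 htinj, fun i j hij => ?_, fun f => ?_⟩,
    CkInterval.tendsto_sum_expansionTerm hab ht0 ht1 htinj ht⟩
  · rcases hij.lt_or_gt with h | h
    · exact CkInterval.sum_expansionTerm_ne hab ht0 ht1 htinj h
    · exact (CkInterval.sum_expansionTerm_ne hab ht0 ht1 htinj h).symm
  · simpa only [_root_.sum_apply] using
      CkInterval.tendsto_sum_expansionTerm hab ht0 ht1 htinj ht f
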